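/- **Architecture.** Write a sequence of $n$ tokens with $D$ features as a matrix with rows $\Phi_1,\dots,\Phi_n\in\mathbb R^D$. Let $\sigma(x)=x/(1+e^{-x})$ (SiLU), $\mathrm{Softplus}(x)=\log(1+e^x)$, and, for a fixed $\eta>0$, let $\mathrm{LayerNorm}(x)_i=\gamma_i\,(x_i-\mu)/\sqrt{s^2+\eta}+\beta_i$, where $\mu$ and $s^2$ are the mean and the (biased) variance of the entries of $x\in\mathbb R^D$ and $\gamma,\beta\in\mathbb R^D$ are learnable. A *bidirectional Mamba block* from width $D$ to width $D'$ has sizes $E,N,K,H$, and computes as follows. With $Z_t=\mathrm{LayerNorm}(\Phi_t)$, the forward scan is $$u_t=\sigma\big(\mathrm{Conv}(W_{\rm input}Z)_t\big)\in\mathbb R^E,\quad B_t=W_Bu_t\in\mathbb R^N,\quad C_t=W_Cu_t\in\mathbb R^N,\quad \Delta_t=\mathrm{Softplus}(W_\Delta u_t)\in\mathbb R^E,$$ where $\mathrm{Conv}$ is a causal depthwise convolution of width $K$ with zero padding and a bias per channel; for each channel $e\le E$, with the diagonal matrix $A_e\in\mathbb R^{N\times N}$ with negative diagonal entries, $$\bar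 A_{t,e}=\exp(\Delta_{t,e}A_e),\qquad \bar B_{t,e}=(\Delta_{t,e}A_e)^{-1}\big(\exp(\Delta_{t,e}A_e)-I\big)\Delta_{t,e}B_t,$$ $$h_{0,e}=0,\qquad h_{t,e}=\bar A_{t,e}h_{t-1,e}+\bar B_{t,e}u_{t,e},\qquad y_{t,e}=C_t^{\top}h_{t,e},$$ and $y^{\rm forward}_t=W_1\big(y_t\odot\sigma(W_2Z_t)\big)\in\mathbb R^H$. The backward scan is the same computation, with its own weights (but the same $A_e$ and the same $\mathrm{LayerNorm}$), on the reversed sequence, with its output reversed again to give $y^{\rm backward}$. The output is $W_{\rm out}(y^{\rm forward}_t+y^{\rm backward}_t)\in\mathbb R^{D'}$, $1\le t\le n$. A *Graph Mamba Network* (GMN) with node tokenization ($m=0$), without message passing, for $d$ node features, $k$ positional features and $d$ outputs per node consists of two nonempty stacks of such blocks, of arbitrary sizes. Given a feature matrix $X\in\mathbb R^{d\times n}$ whose column $x_v$ belongs to node $v$, positional encodings $p_v\in\mathbb R^k$, and an ordering $v_1,\dots,v_n$ of the nodes, it applies the first stack to each one-token sequence $x_v\,\|\,p_v$, arranges the resulting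 node encodings in the order $v_1,\dots,v_n$, applies the second stack to this sequence of length $n$, and returns the matrix in $\mathbb R^{d\times n}$ whose column $v_t$ is the $t$-th row of the result. The *padded adjacency matrix* of a (directed) graph $G$ on $n$ nodes, as positional encoding with $k\ge n$, takes for $p_v$ the row of $v$ in the adjacency matrix of $G$, followed by $k-n$ zeros. **Theorem (Universality).** Let $d,n\ge 0$, $k\ge n$, $\eta>0$, $1\le p<\infty$ and $\varepsilon>0$, and let $f:[0,1]^{d\times n}\to\mathbb R^{d\times n}$ be continuous and permutation equivariant, i.e. $f(X\Pi)=f(X)\Pi$ for every $n\times n$ permutation matrix $\Pi$. Then there is a GMN (sizes and weights as above) such that for every directed graph $G$ on $n$ nodes and every ordering of the nodes, the map $g:[0,1]^{d\times n}\to\mathbb R^{d\times n}$ that it computes with the padded adjacency matrix of $G$ as positional encoding satisfies $$\ell^p(f,g)=\Big(\int_{[0,1]^{d\times n}}\|f(X)-g(X)\|_p^p\,dX\Big)^{1/p}<\varepsilon,$$ where $\|\cdot\|_p$ is the entrywise $p$-norm of matrices. -/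

import Mathlib

open MeasureTheory
open scoped ENNReal Matrix

noncomputable section

namespace GraphMamba

/-- A sequence of `n` tokens with `D` features each: the `n × D` matrix whose rows are the tokens. -/
abbrev TokenSeq (n D : ℕ) : Type := Fin n → Fin D → ℝ

/-- `SiLU(x) = x / (1 + exp (-x))`. -/
def silu (x : ℝ) : ℝ := x / (1 + Real.exp (-x))

/-- `Softplus(x) = log (1 + exp x)`. -/
def softplus (x : ℝ) : ℝ := Real.log (1 + Real.exp x)

/-- The mean of the features of one token. -/
def featureMean {D : ℕ} (x : Fin D → ℝ) : ℝ := (∑ i, x i) / D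

/-- The (biased) variance of the features of one token. -/
def featureVar {D : ℕ} (x : Fin D → ℝ) : ℝ := (∑ i, (x i - featureMean x) ^ 2) / D

/-- Layer normalization of one token, with numerical stabilizer `η`, gain and bias. -/
def layerNorm {D : ℕ} (η : ℝ) (gain bias : Fin D → ℝ) (x : Fin D → ℝ) : Fin D → ℝ :=
  fun i => gain i * ((x i - featureMean x) / Real.sqrt (featureVar x + η)) + bias i

/-- Causal depthwise one-dimensional convolution along the sequence, with kernel width `K`,
zero padding on the left, and a bias for each channel. -/
def causalConv {n E K : ℕ} (kernel : Fin E → Fin K → ℝ) (bias : Fin E → ℝ)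
    (x : TokenSeq n E) : TokenSeq n E :=
  fun t e => (∑ k : Fin K, if (k : ℕ) ≤ (t : ℕ) then
      kernel e k * x ⟨(t : ℕ) - (k : ℕ), lt_of_le_of_lt (Nat.sub_le _ _) t.isLt⟩ e else 0) + bias e

/-- Zero-order-hold discretization `Ā = exp (Δ A)` of one (diagonal) entry of `A`. -/
def discreteA (a δ : ℝ) : ℝ := Real.exp (δ * a)

/-- Zero-order-hold discretization `B̄ = (Δ A)⁻¹ (exp (Δ A) - 1) Δ B`, for one (diagonal) entry
of `A`. -/
def discreteB (a b δ : ℝ) : ℝ := (δ * a)⁻¹ * (Real.exp (δ * a) - 1) * (δ * b)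

/-- The latent state after the first `t` tokens: it is `0` before the first token, and
`h_t = Ā_t h_{t-1} + B̄_t x_t`. There is one state vector of size `N` for each of the `E` channels,
and `Ā_t` is diagonal on it. -/
def ssmState {n E N : ℕ} (Abar Bbar : Fin n → Fin E → Fin N → ℝ) (x : TokenSeq n E) :
    (t : ℕ) → t ≤ n → Fin E → Fin N → ℝ
  | 0, _ => fun _ _ => 0
  | t + 1, h => fun e i =>
      Abar ⟨t, h⟩ e i * ssmState Abar Bbar x t (Nat.le_of_succ_le h) e i
        + Bbar ⟨t, h⟩ e i * x ⟨t, h⟩ e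

/-- The output `y_t = C_t h_t` of the time-varying state space model, in each channel. -/
def ssm {n E N : ℕ} (Abar Bbar : Fin n → Fin E → Fin N → ℝ) (C : Fin n → Fin N → ℝ)
    (x : TokenSeq n E) : TokenSeq n E :=
  fun t e => ∑ i, C t i * ssmState Abar Bbar x ((t : ℕ) + 1) t.isLt e i

/-- The learnable weights of one scan direction: input width `D`, `E` channels, state size `N`,
convolution width `K`, output width `H`. -/
structure ScanWeights (D E N K H : ℕ) where
  Winput : Matrix (Fin E) (Fin D) ℝ
  convKernel : Fin E → Fin K → ℝ
  convBias : Fin E → ℝ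
  WB : Matrix (Fin N) (Fin E) ℝ
  WC : Matrix (Fin N) (Fin E) ℝ
  WΔ : Matrix (Fin E) (Fin E) ℝ
  W₁ : Matrix (Fin H) (Fin E) ℝ
  W₂ : Matrix (Fin E) (Fin D) ℝ

/-- `Φ_input = SiLU (Conv (W_input z))`, for the layer-normalized sequence `z`. -/
def ScanWeights.input {D E N K H n : ℕ} (w : ScanWeights D E N K H) (z : TokenSeq n D) :
    TokenSeq n E :=
  fun t e => silu (causalConv w.convKernel w.convBias (fun s => w.Winput *ᵥ z s) t e)

/-- One directional scan of a selective state space model with gated output, applied to the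
layer-normalized sequence `z`. The parameters `B`, `C` and `Δ` are functions of the input; `A e` is
the diagonal of the evolution matrix of channel `e`. -/
def ScanWeights.scan {D E N K H n : ℕ} (w : ScanWeights D E N K H) (A : Fin E → Fin N → ℝ)
    (z : TokenSeq n D) : TokenSeq n H :=
  let u : TokenSeq n E := w.input z
  let B : Fin n → Fin N → ℝ := fun t => w.WB *ᵥ u t
  let C : Fin n → Fin N → ℝ := fun t => w.WC *ᵥ u t
  let Δ : Fin n → Fin E → ℝ := fun t e => softplus ((w.WΔ *ᵥ u t) e)
  let Abar : Fin n → Fin E → Fin N → ℝ := fun t e i => discreteA (A e i) (Δ t e)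
  let Bbar : Fin n → Fin E → Fin N → ℝ := fun t e i => discreteB (A e i) (B t i) (Δ t e)
  let y : TokenSeq n E := ssm Abar Bbar C u
  fun t => w.W₁ *ᵥ (fun e => y t e * silu ((w.W₂ *ᵥ z t) e))

/-- A bidirectional Mamba block from width `D` to width `D'`: sizes, layer normalization
parameters, the evolution matrices (diagonal, with negative entries, common to both directions),
separate weights for the forward and the backward scan, and the output projection. -/
structure BiMamba (D D' : ℕ) where
  (E N K H : ℕ)
  gain : Fin D → ℝ
  bias : Fin D → ℝ
  A : Fin E → Fin N → ℝ
  A_neg : ∀ e i, A e i < 0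
  forward : ScanWeights D E N K H
  backward : ScanWeights D E N K H
  Wout : Matrix (Fin D') (Fin H) ℝ

/-- Reverse the order of the tokens. -/
def reverseRows {n D : ℕ} (x : TokenSeq n D) : TokenSeq n D := fun t => x t.rev

/-- The map computed by a bidirectional Mamba block on sequences of length `n`:
`W_out (y_forward + y_backward)`. -/
def BiMamba.eval {D D' n : ℕ} (η : ℝ) (b : BiMamba D D') (x : TokenSeq n D) : TokenSeq n D' :=
  let z : TokenSeq n D := fun t => layerNorm η b.gain b.bias (x t)
  let yf : TokenSeq n b.H := b.forward.scan b.A z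
  let yb : TokenSeq n b.H := reverseRows (b.backward.scan b.A (reverseRows z))
  fun t => b.Wout *ᵥ (yf t + yb t)

/-- A nonempty stack of bidirectional Mamba blocks from width `D` to width `D'`. -/
inductive BiMambaStack : ℕ → ℕ → Type
  | single {D D' : ℕ} (b : BiMamba D D') : BiMambaStack D D'
  | cons {D D₁ D' : ℕ} (b : BiMamba D D₁) (s : BiMambaStack D₁ D') : BiMambaStack D D'

/-- The map computed by a stack of blocks; the leading block is applied first. -/
def BiMambaStack.eval (η : ℝ) {n : ℕ} :
    {D D' : ℕ} → BiMambaStack D D' → TokenSeq n D → TokenSeq n D'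
  | _, _, .single b, x => b.eval η x
  | _, _, .cons b s, x => s.eval η (b.eval η x)

/-- A Graph Mamba Network with node tokenization and without message passing, for `d` node features
and `k` positional features and with `d` output features per node: the layers that process the
token sequence of each node separately, and the last layers, which scan the nodes. -/
structure GMN (d k : ℕ) where
  width : ℕ
  nodeLayers : BiMambaStack (d + k) width
  lastLayers : BiMambaStack width d

/-- The map computed by a Graph Mamba Network on a feature matrix `X` (column `v` holds the features
of node `v`), given positional encodings `P v` of the nodes and an ordering of the nodes
(`order t` is the node at place `t`). The positional encoding is concatenated to the features; the
token sequence of a node consists of that node alone; the last layers scan the resulting node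
encodings in the given order, and column `v` of the result is the output at node `v`. -/
def GMN.eval {d k n : ℕ} (η : ℝ) (g : GMN d k) (P : Fin n → Fin k → ℝ)
    (order : Equiv.Perm (Fin n)) (X : Fin d → Fin n → ℝ) : Fin d → Fin n → ℝ :=
  let token : Fin n → Fin (d + k) → ℝ := fun v => Fin.append (fun i => X i v) (P v)
  let enc : Fin n → Fin g.width → ℝ := fun v =>
    g.nodeLayers.eval η (fun _ : Fin 1 => token v) 0
  let out : TokenSeq n d := g.lastLayers.eval η (fun t => enc (order t))
  fun i v => out (order.symm v) i

open Classical in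
/-- The adjacency matrix of a graph on `n` nodes, padded with zero columns to width `k`;
row `v` is the positional encoding of node `v`. -/
def paddedAdjacency {n : ℕ} (G : Digraph (Fin n)) (k : ℕ) : Fin n → Fin k → ℝ :=
  fun v j => if ∃ h : (j : ℕ) < n, G.Adj v ⟨j, h⟩ then 1 else 0

/-- The cube `[0,1]^{d × n}`. -/
def cube (d n : ℕ) : Set (Fin d → Fin n → ℝ) := {X | ∀ i v, X i v ∈ Set.Icc (0 : ℝ) 1}

/-- `f (X π) = f (X) π` for every permutation `π` of the columns and every `X` in the cube. -/
def PermutationEquivariant {d n : ℕ} (f : (Fin d → Fin n → ℝ) → (Fin d → Fin n → ℝ)) : Prop :=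
  ∀ (π : Equiv.Perm (Fin n)), ∀ X ∈ cube d n,
    f (fun i v => X i (π v)) = fun i v => f X i (π v)

/-- The `p`-norm distance `(∫_{[0,1]^{d × n}} ‖f X - g X‖_p ^ p dX) ^ (1 / p)`, where `‖·‖_p` is the
entrywise `p`-norm of matrices and `dX` is Lebesgue measure. -/
def lpDist {d n : ℕ} (p : ℝ) (f g : (Fin d → Fin n → ℝ) → (Fin d → Fin n → ℝ)) : ℝ≥0∞ :=
  (∫⁻ X in cube d n, ENNReal.ofReal (∑ i, ∑ v, |f X i v - g X i v| ^ p)) ^ (1 / p)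

end GraphMamba

end

noncomputable section

namespace GraphMamba

/-! The selection mechanism can be frozen. One channel with zero kernel and bias `1` carries the
constant `silu 1`, so `B`, `C`, `Δ` can be made constant; normalized tokens have a fixed sum, so the
gate can be made constant too. With `A = -1` and `Δ = log 2` the scan becomes `h_t = h_{t-1} / 2 +
u_t`. This recurrence is inverted by the filter `m_t - m_{t-1} / 2`, either exactly in the
convolution or approximately in a network feeding the scan.

Two kinds of block result. Since `silu x - silu (-x) = x`, paired channels act linearly, and the
filter composed with a delay gives arbitrary shifts in both directions (`exists_shift_block`).
Without delays a block is a network with one hidden layer on each token, followed by the recurrence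
(`exists_network_block`). Such networks are dense in the continuous functions on a compact set
(`exists_silu_network`).

Shifts collect the whole sequence in every token. Padding zeros reveal the position, because no
normalized token vanishes. Layer normalization loses only a translation of each original token. A
positional entry in `{0, 1}` restricts the translation to `-1`, `0` or `1`, and features in `[δ, 1]`
then force it to be `0` (`representation_injOn`). So every continuous target is a continuous
function of the representation, and equivariance makes the target consistent for all orderings; all
graphs are covered because the compact token set allows every 0/1 encoding.

Near the faces where a feature vanishes only a bound is available. Tietze extension makes it
independent of `δ`, so this region contributes little to the integral when `δ` is small. -/

/-! ### SiLU compared with the identity and the ramp. -/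

theorem silu_sub_silu_neg (x : ℝ) : silu x - silu (-x) = x := by
  have h := Real.exp_pos x
  simp only [silu, neg_neg, Real.exp_neg]
  field_simp
  ring

theorem continuous_silu : Continuous silu := by
  unfold silu
  refine continuous_id.div (by fun_prop) fun x => ?_
  have := Real.exp_pos (-x)
  positivity

theorem silu_one_pos : 0 < silu 1 := by
  unfold silu
  positivity

/-- The difference is `-y / (1 + exp y)` with `y = |x|`, and `y + 1 ≤ exp y`. -/
theorem abs_silu_sub_relu_le (x : ℝ) : |silu x - max x 0| ≤ 1 := by
  have key : ∀ y : ℝ, 0 ≤ y → y / (1 + Real.exp y) ≤ 1 := fun y _ => by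
    rw [div_le_one (by positivity)]
    linarith [Real.add_one_le_exp y]
  rcases le_total 0 x with hx | hx
  · have h1 : silu x - max x 0 = -(x / (1 + Real.exp x)) := by
      rw [max_eq_left hx]
      have := silu_sub_silu_neg x
      have h2 : silu (-x) = -(x / (1 + Real.exp x)) := by simp [silu, neg_div]
      linarith
    rw [h1, abs_neg, abs_of_nonneg (by positivity)]
    exact key x hx
  · have h1 : silu x - max x 0 = -(-x / (1 + Real.exp (-x))) := by
      rw [max_eq_right hx, silu]; ring
    rw [h1, abs_neg, abs_of_nonneg (div_nonneg (by linarith) (by positivity))]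
    exact key (-x) (by linarith)

theorem abs_silu_mul_div_sub_relu_le {l : ℝ} (hl : 0 < l) (x : ℝ) :
    |l⁻¹ * silu (l * x) - max x 0| ≤ l⁻¹ := by
  have h : max x 0 = l⁻¹ * max (l * x) 0 := by
    rw [mul_max_of_nonneg _ _ (by positivity), mul_zero, inv_mul_cancel_left₀ hl.ne']
  rw [h, ← mul_sub, abs_mul, abs_of_pos (inv_pos.2 hl)]
  exact mul_le_of_le_one_right (by positivity) (abs_silu_sub_relu_le _)

/-- `exp` on `[-R, R]` as a superposition of ramps. -/
theorem integral_exp_mul_relu {R y : ℝ} (h1 : -R ≤ y) (h2 : y ≤ R) :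
    ∫ s in (-R)..R, Real.exp s * max (y - s) 0 = Real.exp y - Real.exp (-R) * (y + R + 1) := by
  have hc : ∀ a b : ℝ, IntervalIntegrable (fun s => Real.exp s * max (y - s) 0) volume a b :=
    fun a b => Continuous.intervalIntegrable (by fun_prop) a b
  rw [← intervalIntegral.integral_add_adjacent_intervals (hc (-R) y) (hc y R)]
  have e1 : ∫ s in (-R)..y, Real.exp s * max (y - s) 0
      = ∫ s in (-R)..y, Real.exp s * (y - s) := by
    refine intervalIntegral.integral_congr fun s hs => ?_
    rw [Set.uIcc_of_le h1] at hs
    rw [max_eq_left (by linarith [hs.2])]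
  have e2 : ∫ s in y..R, Real.exp s * max (y - s) 0 = ∫ s in y..R, (0 : ℝ) := by
    refine intervalIntegral.integral_congr fun s hs => ?_
    rw [Set.uIcc_of_le h2] at hs
    rw [max_eq_right (by linarith [hs.1]), mul_zero]
  have e3 : ∫ s in (-R)..y, Real.exp s * (y - s)
      = Real.exp y * (y - y + 1) - Real.exp (-R) * (y - -R + 1) := by
    refine intervalIntegral.integral_eq_sub_of_hasDerivAt
      (f := fun s => Real.exp s * (y - s + 1)) (fun s _ => ?_)
      (Continuous.intervalIntegrable (by fun_prop) _ _)
    have := (Real.hasDerivAt_exp s).mul (((hasDerivAt_id s).const_sub y).add_const 1)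
    refine this.congr_deriv ?_
    simp only [id]
    ring
  rw [e1, e2, e3]
  simp only [intervalIntegral.integral_zero]
  ring

/-! ### Density of networks with one hidden layer. -/

section Approximation

variable {W : ℕ} (K : Set (Fin W → ℝ))

theorem continuous_dotProduct_val (w : Fin W → ℝ) :
    Continuous fun x : K => w ⬝ᵥ (x : Fin W → ℝ) :=
  continuous_const.dotProduct continuous_subtype_val

/-- The neuron `x ↦ silu (w ⬝ x + b)` on the set `K`. -/
def neuron (w : Fin W → ℝ) (b : ℝ) : C(K, ℝ) where
  toFun x := silu (w ⬝ᵥ (x : Fin W → ℝ) + b)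
  continuous_toFun := continuous_silu.comp ((continuous_dotProduct_val K w).add continuous_const)

/-- The ramp `x ↦ max (w ⬝ x - s) 0` on the set `K`. -/
def ramp (w : Fin W → ℝ) (s : ℝ) : C(K, ℝ) where
  toFun x := max (w ⬝ᵥ (x : Fin W → ℝ) - s) 0
  continuous_toFun := ((continuous_dotProduct_val K w).sub continuous_const).max continuous_const

/-- The exponential `x ↦ exp (w ⬝ x)` on the set `K`. -/
def expDot (w : Fin W → ℝ) : C(K, ℝ) where
  toFun x := Real.exp (w ⬝ᵥ (x : Fin W → ℝ))
  continuous_toFun := Real.continuous_exp.comp (continuous_dotProduct_val K w)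

/-- The functions computed by networks with one hidden layer. -/
def neuronSpan : Submodule ℝ C(K, ℝ) :=
  Submodule.span ℝ (Set.range fun q : (Fin W → ℝ) × ℝ => neuron K q.1 q.2)

theorem continuous_ramp (w : Fin W → ℝ) : Continuous fun s => ramp K w s := by
  refine ContinuousMap.continuous_of_continuous_uncurry _ ?_
  simp only [Function.uncurry_def, ramp, ContinuousMap.coe_mk]
  exact (((continuous_dotProduct_val K w).comp continuous_snd).sub continuous_fst).max
    continuous_const

variable [CompactSpace K]

theorem ramp_mem_closure (w : Fin W → ℝ) (s : ℝ) :
    ramp K w s ∈ (neuronSpan K).topologicalClosure := by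
  rw [← SetLike.mem_coe, Submodule.topologicalClosure_coe, Metric.mem_closure_iff]
  intro ε hε
  have hl : 0 < 2 / ε := by positivity
  refine ⟨(2 / ε)⁻¹ • neuron K ((2 / ε) • w) (-((2 / ε) * s)), Submodule.smul_mem _ _
    (Submodule.subset_span ⟨((2 / ε) • w, -((2 / ε) * s)), rfl⟩), ?_⟩
  refine lt_of_le_of_lt ((ContinuousMap.dist_le (C := ε / 2) (by positivity)).2 fun x => ?_)
    (half_lt_self hε)
  have h := abs_silu_mul_div_sub_relu_le hl (w ⬝ᵥ (x : Fin W → ℝ) - s)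
  rw [dist_comm, Real.dist_eq]
  simp only [ContinuousMap.smul_apply, neuron, ramp, ContinuousMap.coe_mk, smul_dotProduct,
    smul_eq_mul]
  rw [mul_sub, sub_eq_add_neg, inv_div] at h
  rw [inv_div]
  exact h

/-- An exponential is an integral of ramps plus an affine correction, and a closed subspace contains
integrals of its elements. -/
theorem expDot_mem_closure (w : Fin W → ℝ) :
    expDot K w ∈ (neuronSpan K).topologicalClosure := by
  set V := (neuronSpan K).topologicalClosure with hV
  have hVc : IsClosed (V : Set C(K, ℝ)) := Submodule.isClosed_topologicalClosure _
  obtain ⟨R, hR⟩ : ∃ R : ℝ, ∀ x : K, |w ⬝ᵥ (x : Fin W → ℝ)| ≤ R := by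
    obtain ⟨R, hR⟩ := isCompact_univ.exists_bound_of_continuousOn (s := (Set.univ : Set K))
      (f := fun x : K => w ⬝ᵥ (x : Fin W → ℝ))
      (continuous_dotProduct_val K w).continuousOn
    exact ⟨R, fun x => hR x trivial⟩
  have hint : (∫ s in (-R)..R, Real.exp s • ramp K w s) ∈ V := by
    have : IsClosed (V : Set C(K, ℝ)) := hVc
    -- The quotient map commutes with the integral and kills the integrand.
    rw [← Submodule.ker_mkQ V, LinearMap.mem_ker]
    have h := ContinuousLinearMap.intervalIntegral_comp_comm (𝕜 := ℝ) (F := C(K, ℝ) ⧸ V) V.mkQL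
      (μ := volume) (a := -R) (b := R)
      (f := fun s => Real.exp s • ramp K w s)
      ((Real.continuous_exp.smul (continuous_ramp K w)).intervalIntegrable _ _)
    have h0 : ∀ s, V.mkQL (Real.exp s • ramp K w s) = 0 := fun s =>
      (Submodule.Quotient.mk_eq_zero V).2 (V.smul_mem _ (ramp_mem_closure K w s))
    simp only [h0, intervalIntegral.integral_zero] at h
    exact h.symm
  -- On `K` the two extra ramps are `w ⬝ x + R` and the constant `1`.
  have heq : expDot K w = (∫ s in (-R)..R, Real.exp s • ramp K w s)
      + Real.exp (-R) • (ramp K w (-R) + (ramp K 0 (-1))) := by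
    ext x
    have h := (ContinuousMap.evalCLM ℝ x).intervalIntegral_comp_comm (μ := volume) (a := -R)
      (b := R) (f := fun s => Real.exp s • ramp K w s)
      ((Real.continuous_exp.smul (continuous_ramp K w)).intervalIntegrable _ _)
    simp only [ContinuousMap.evalCLM_apply, ContinuousMap.smul_apply, smul_eq_mul] at h
    have hx := abs_le.1 (hR x)
    have h2 := integral_exp_mul_relu hx.1 hx.2
    simp only [ramp, ContinuousMap.coe_mk] at h
    rw [h2] at h
    simp only [ContinuousMap.add_apply, ContinuousMap.smul_apply, smul_eq_mul]
    erw [← h]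
    simp only [expDot, ramp, ContinuousMap.coe_mk, zero_dotProduct]
    rw [max_eq_left (by linarith), max_eq_left (by norm_num)]
    ring
  rw [heq]
  exact V.add_mem hint (V.smul_mem _ (V.add_mem (ramp_mem_closure K _ _) (ramp_mem_closure K _ _)))

/-- The exponentials `x ↦ exp (w ⬝ x)` form a monoid. -/
def expMonoid : Submonoid C(K, ℝ) where
  carrier := Set.range (expDot K)
  one_mem' := ⟨0, by ext x; simp [expDot]⟩
  mul_mem' := by
    rintro _ _ ⟨w, rfl⟩ ⟨w', rfl⟩
    exact ⟨w + w', by ext x; simp [expDot, add_dotProduct, Real.exp_add]⟩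

/-- Exponentials are closed under products, so their linear span is already an algebra. It separates
points, and Stone–Weierstrass applies. -/
theorem neuronSpan_topologicalClosure : (neuronSpan K).topologicalClosure = ⊤ := by
  have hsep : (Algebra.adjoin ℝ (expMonoid K : Set C(K, ℝ))).SeparatesPoints := by
    intro x y hxy
    obtain ⟨i, hi⟩ : ∃ i, (x : Fin W → ℝ) i ≠ (y : Fin W → ℝ) i := by
      by_contra! h
      exact hxy (Subtype.ext (funext h))
    refine ⟨expDot K (Pi.single i 1), ⟨_, Algebra.subset_adjoin ⟨_, rfl⟩, rfl⟩, ?_⟩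
    simpa [expDot] using hi
  have htop := ContinuousMap.subalgebra_topologicalClosure_eq_top_of_separatesPoints _ hsep
  have hle : Subalgebra.toSubmodule (Algebra.adjoin ℝ (expMonoid K : Set C(K, ℝ)))
      ≤ (neuronSpan K).topologicalClosure := by
    rw [Algebra.adjoin_eq_span, Submonoid.closure_eq, Submodule.span_le]
    rintro _ ⟨w, rfl⟩
    exact expDot_mem_closure K w
  rw [eq_top_iff]
  intro g _
  have hg : g ∈ (Algebra.adjoin ℝ (expMonoid K : Set C(K, ℝ))).topologicalClosure := by
    rw [htop]; trivial
  rw [← SetLike.mem_coe, Subalgebra.topologicalClosure_coe] at hg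
  exact closure_minimal hle (Submodule.isClosed_topologicalClosure _) hg

end Approximation

/-- Universal approximation by networks with one hidden layer of SiLU neurons. -/
theorem exists_silu_network {W : ℕ} {K : Set (Fin W → ℝ)} (hK : IsCompact K)
    (h : C(Fin W → ℝ, ℝ)) {ε : ℝ} (hε : 0 < ε) :
    ∃ (E : ℕ) (w : Fin E → Fin W → ℝ) (b c : Fin E → ℝ),
      ∀ x ∈ K, |∑ e, c e * silu (w e ⬝ᵥ x + b e) - h x| < ε := by
  have : CompactSpace K := isCompact_iff_compactSpace.1 hK
  have hmem : h.restrict K ∈ (neuronSpan K).topologicalClosure := by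
    rw [neuronSpan_topologicalClosure]; trivial
  rw [← SetLike.mem_coe, Submodule.topologicalClosure_coe, Metric.mem_closure_iff] at hmem
  obtain ⟨g, hg, hdist⟩ := hmem ε hε
  obtain ⟨E, c, q, hq⟩ := Submodule.mem_span_set'.1 hg
  choose r hr using fun e => (q e).2
  refine ⟨E, fun e => (r e).1, fun e => (r e).2, c, fun x hx => ?_⟩
  have hx' := (ContinuousMap.dist_lt_iff hε).1 hdist ⟨x, hx⟩
  rw [dist_comm, Real.dist_eq, ← hq] at hx'
  have hsum : (∑ e, c e • (q e : C(K, ℝ))) ⟨x, hx⟩ = ∑ e, c e * silu ((r e).1 ⬝ᵥ x + (r e).2) := by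
    rw [ContinuousMap.sum_apply]
    refine Finset.sum_congr rfl fun e _ => ?_
    rw [← hr e]
    rfl
  rw [hsum] at hx'
  exact hx'

/-- Several functions can be approximated by networks with the same hidden layer. -/
theorem exists_silu_network_pi {W d : ℕ} {K : Set (Fin W → ℝ)} (hK : IsCompact K)
    (h : Fin d → C(Fin W → ℝ, ℝ)) {ε : ℝ} (hε : 0 < ε) :
    ∃ (E : ℕ) (w : Fin E → Fin W → ℝ) (b : Fin E → ℝ) (c : Fin d → Fin E → ℝ),
      ∀ i, ∀ x ∈ K, |∑ e, c i e * silu (w e ⬝ᵥ x + b e) - h i x| < ε := by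
  choose E w b c H using fun i => exists_silu_network hK (h i) hε
  let q : (Σ i, Fin (E i)) ≃ Fin (∑ i, E i) := finSigmaFinEquiv
  refine ⟨∑ i, E i, fun e => w (q.symm e).1 (q.symm e).2, fun e => b (q.symm e).1 (q.symm e).2,
    fun i e => if (q.symm e).1 = i then c (q.symm e).1 (q.symm e).2 else 0, fun i x hx => ?_⟩
  have key : ∀ F : (Σ i, Fin (E i)) → ℝ, ∑ e, F (q.symm e) = ∑ i, ∑ j, F ⟨i, j⟩ := fun F =>
    (q.symm.sum_comp F).trans (Fintype.sum_sigma F)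
  rw [key fun s => (if s.1 = i then c s.1 s.2 else 0) * silu (w s.1 s.2 ⬝ᵥ x + b s.1 s.2),
    Finset.sum_eq_single i]
  · simpa using H i x hx
  · intro j _ hj
    simp [hj]
  · simp

/-! ### The recurrence with decay one half. -/

/-- The recurrence `h_t = h_{t-1} / 2 + u_t`, `h_0 = 0`. -/
def halfScan {n : ℕ} (u : Fin n → ℝ) : (t : ℕ) → t ≤ n → ℝ
  | 0, _ => 0
  | t + 1, h => 2⁻¹ * halfScan u t (Nat.le_of_succ_le h) + u ⟨t, h⟩

theorem sum_mul_halfScan {n : ℕ} {ι : Type*} [Fintype ι] (c : ι → ℝ) (u : ι → Fin n → ℝ)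
    (t : ℕ) (h : t ≤ n) :
    ∑ e, c e * halfScan (u e) t h = halfScan (fun s => ∑ e, c e * u e s) t h := by
  induction t with
  | zero => simp [halfScan]
  | succ t ih =>
    simp only [halfScan]
    rw [← ih (Nat.le_of_succ_le h), Finset.mul_sum, ← Finset.sum_add_distrib]
    exact Finset.sum_congr rfl fun e _ => by ring

theorem halfScan_zero {n : ℕ} (t : ℕ) (h : t ≤ n) : halfScan (fun _ : Fin n => 0) t h = 0 := by
  induction t with
  | zero => rfl
  | succ t ih => simp [halfScan, ih]

/-- The input `m (t + 1) - m t / 2` reproduces `m`. Errors stay bounded uniformly in `n`, since `2ε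
/ 2 + ε = 2ε`. -/
theorem abs_halfScan_sub_le {n : ℕ} (u : Fin n → ℝ) (m : ℕ → ℝ) (hm : m 0 = 0) {ε : ℝ}
    (hε : 0 ≤ ε) (hu : ∀ t (h : t < n), |u ⟨t, h⟩ - (m (t + 1) - 2⁻¹ * m t)| ≤ ε)
    (t : ℕ) (h : t ≤ n) : |halfScan u t h - m t| ≤ 2 * ε := by
  induction t with
  | zero => simpa [halfScan, hm] using hε
  | succ t ih =>
    have h1 := abs_le.1 (ih (Nat.le_of_succ_le h))
    have h2 := abs_le.1 (hu t h)
    simp only [halfScan]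
    rw [abs_le]
    constructor <;> linarith [h1.1, h1.2, h2.1, h2.2]

theorem halfScan_eq {n : ℕ} (u : Fin n → ℝ) (m : ℕ → ℝ) (hm : m 0 = 0)
    (hu : ∀ t (h : t < n), u ⟨t, h⟩ = m (t + 1) - 2⁻¹ * m t) (t : ℕ) (h : t ≤ n) :
    halfScan u t h = m t := by
  have := abs_halfScan_sub_le u m hm le_rfl (fun t h => by simp [hu t h]) t h
  rw [mul_zero] at this
  linarith [abs_nonpos_iff.1 this]

theorem ssmState_eq_halfScan {n E N : ℕ} (Abar Bbar : Fin n → Fin E → Fin N → ℝ)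
    (x : TokenSeq n E) (e : Fin E) (i : Fin N) (hA : ∀ t, Abar t e i = 2⁻¹)
    (hB : ∀ t, Bbar t e i = 1) (t : ℕ) (h : t ≤ n) :
    ssmState Abar Bbar x t h e i = halfScan (fun s => x s e) t h := by
  induction t with
  | zero => rfl
  | succ t ih => simp only [ssmState, halfScan, hA, hB, ih, one_mul]

/-! ### Scans with frozen selection. -/

/-- Scan weights whose selection and gate are constant. The leading channel is constant. -/
def linearScan {D E K H : ℕ} (w : Matrix (Fin E) (Fin D) ℝ) (kernel : Fin E → Fin K → ℝ)
    (bias : Fin E → ℝ) (c : Matrix (Fin H) (Fin E) ℝ) : ScanWeights D (E + 1) 1 K H where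
  Winput := Fin.cons (fun _ => 0) w
  convKernel := Fin.cons (fun _ => 0) kernel
  convBias := Fin.cons 1 bias
  WB := fun _ => Fin.cons (2 * (silu 1)⁻¹) fun _ => 0
  WC := fun _ => Fin.cons (silu 1)⁻¹ fun _ => 0
  WΔ := 0
  W₁ := fun o => Fin.cons 0 fun e => c o e * (silu 1)⁻¹
  W₂ := fun _ _ => (D : ℝ)⁻¹

theorem discreteA_neg_one_log_two : discreteA (-1) (Real.log 2) = 2⁻¹ := by
  rw [discreteA, mul_neg_one, Real.exp_neg, Real.exp_log two_pos]

theorem discreteB_neg_one_log_two : discreteB (-1) 2 (Real.log 2) = 1 := by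
  have h : Real.log 2 ≠ 0 := (Real.log_pos one_lt_two).ne'
  rw [discreteB, mul_neg_one, Real.exp_neg, Real.exp_log two_pos]
  field_simp
  norm_num

section linearScan

variable {D E K H n : ℕ} (w : Matrix (Fin E) (Fin D) ℝ) (kernel : Fin E → Fin K → ℝ)
  (bias : Fin E → ℝ) (c : Matrix (Fin H) (Fin E) ℝ) (z : TokenSeq n D)

theorem linearScan_input_zero (t : Fin n) : (linearScan w kernel bias c).input z t 0 = silu 1 := by
  simp [ScanWeights.input, linearScan, causalConv]

theorem linearScan_input_succ (t : Fin n) (e : Fin E) :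
    (linearScan w kernel bias c).input z t e.succ
      = silu (causalConv kernel bias (fun s => w *ᵥ z s) t e) := by
  simp [ScanWeights.input, linearScan, causalConv, Matrix.mulVec]
  rfl

/-- The constant channel gives `B = 2` and `C = 1`, and `WΔ = 0` gives `Δ = softplus 0 = log 2`;
hence the decay is `1/2` and the input coefficient `1`. By `hz` the gate is `silu 1`, which the
factor in `W₁` cancels. -/
theorem linearScan_scan (hD : 0 < D) (hz : ∀ t, ∑ i, z t i = D) (t : Fin n) (o : Fin H) :
    (linearScan w kernel bias c).scan (fun _ _ => -1) z t o
      = halfScan (fun s => ∑ e, c o e *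
          silu (causalConv kernel bias (fun s => w *ᵥ z s) s e)) (t + 1) t.isLt := by
  have hs : silu 1 ≠ 0 := silu_one_pos.ne'
  have hD' : (D : ℝ) ≠ 0 := by positivity
  have hB : ∀ s i, ((linearScan w kernel bias c).WB *ᵥ (linearScan w kernel bias c).input z s) i
      = 2 := fun s i => by
    simp only [Matrix.mulVec, dotProduct, Fin.sum_univ_succ, linearScan_input_zero]
    simp [linearScan, hs]
  have hC : ∀ s i, ((linearScan w kernel bias c).WC *ᵥ (linearScan w kernel bias c).input z s) i
      = 1 := fun s i => by
    simp only [Matrix.mulVec, dotProduct, Fin.sum_univ_succ, linearScan_input_zero]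
    simp [linearScan, hs]
  have hΔ : ∀ s e, softplus (((linearScan w kernel bias c).WΔ *ᵥ
      (linearScan w kernel bias c).input z s) e) = Real.log 2 := fun s e => by
    simp [linearScan, softplus, one_add_one_eq_two]
  have hg : ∀ e, ((linearScan w kernel bias c).W₂ *ᵥ z t) e = 1 := fun e => by
    simp only [Matrix.mulVec, dotProduct, linearScan]
    rw [← Finset.mul_sum, hz, inv_mul_cancel₀ hD']
  simp only [ScanWeights.scan, hB, hC, hΔ, ssm]
  rw [← sum_mul_halfScan]
  simp only [Matrix.mulVec, dotProduct] at hg ⊢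
  simp only [hg, Fin.sum_univ_succ, Fin.sum_univ_zero, one_mul, add_zero]
  have key : ∀ e : Fin (E + 1), ssmState
      (fun (_ : Fin n) (_ : Fin (E + 1)) (_ : Fin 1) => discreteA (-1) (Real.log 2))
      (fun (_ : Fin n) (_ : Fin (E + 1)) (_ : Fin 1) => discreteB (-1) 2 (Real.log 2))
      ((linearScan w kernel bias c).input z) (t + 1) t.isLt e 0
      = halfScan (fun s => (linearScan w kernel bias c).input z s e) (t + 1) t.isLt := fun e =>
    ssmState_eq_halfScan _ _ _ _ _ (fun _ => discreteA_neg_one_log_two)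
      (fun _ => discreteB_neg_one_log_two) _ _
  have h0 : (linearScan w kernel bias c).W₁ o 0 = 0 := rfl
  have h1 : ∀ e : Fin E, (linearScan w kernel bias c).W₁ o e.succ = c o e * (silu 1)⁻¹ :=
    fun _ => rfl
  simp only [h0, h1, zero_mul, zero_add]
  refine Finset.sum_congr rfl fun e _ => ?_
  refine (congrArg (fun r => c o e * (silu 1)⁻¹ * (r * silu 1)) (key e.succ)).trans ?_
  simp only [linearScan_input_succ]
  field_simp

end linearScan

/-! ### Blocks that act as networks or as shifts. -/

/-- Layer normalization with gain and bias `1`. -/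
def normalize {D : ℕ} (η : ℝ) (x : Fin D → ℝ) : Fin D → ℝ :=
  layerNorm η (fun _ => 1) (fun _ => 1) x

theorem sum_sub_featureMean {D : ℕ} (x : Fin D → ℝ) : ∑ i, (x i - featureMean x) = 0 := by
  rcases Nat.eq_zero_or_pos D with rfl | hD
  · simp
  · have hD' : (D : ℝ) ≠ 0 := by positivity
    simp only [Finset.sum_sub_distrib, Finset.sum_const, Finset.card_univ, Fintype.card_fin,
      nsmul_eq_mul, featureMean]
    field_simp
    ring

/-- The centred part sums to zero, so only the bias `1` contributes. This invariant fixes the gate,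
and later rules out translations of normalized tokens. -/
theorem sum_normalize {D : ℕ} (η : ℝ) (x : Fin D → ℝ) : ∑ i, normalize η x i = D := by
  simp only [normalize, layerNorm, one_mul, Finset.sum_add_distrib, ← Finset.sum_div,
    sum_sub_featureMean]
  simp

/-- The block with constant selection and gate in both directions. -/
def linearBlock {D D' E K : ℕ} (wf wb : Matrix (Fin E) (Fin D) ℝ) (kf kb : Fin E → Fin K → ℝ)
    (bf bb : Fin E → ℝ) (cf cb : Matrix (Fin D') (Fin E) ℝ) : BiMamba D D' where
  E := E + 1
  N := 1
  K := K
  H := D'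
  gain := fun _ => 1
  bias := fun _ => 1
  A := fun _ _ => -1
  A_neg := fun _ _ => by norm_num
  forward := linearScan wf kf bf cf
  backward := linearScan wb kb bb cb
  Wout := 1

theorem linearBlock_eval {D D' E K n : ℕ} (hD : 0 < D) (wf wb : Matrix (Fin E) (Fin D) ℝ)
    (kf kb : Fin E → Fin K → ℝ) (bf bb : Fin E → ℝ) (cf cb : Matrix (Fin D') (Fin E) ℝ)
    (η : ℝ) (x : TokenSeq n D) (t : Fin n) (o : Fin D') :
    (linearBlock wf wb kf kb bf bb cf cb).eval η x t o
      = halfScan (fun s => ∑ e, cf o e *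
          silu (causalConv kf bf (fun r => wf *ᵥ normalize η (x r)) s e)) (t + 1) t.isLt
        + halfScan (fun s => ∑ e, cb o e *
          silu (causalConv kb bb (fun r => wb *ᵥ normalize η (x r.rev)) s e))
            (t.rev + 1) t.rev.isLt := by
  have h1 := linearScan_scan wf kf bf cf (fun r => normalize η (x r)) hD
    (fun _ => sum_normalize _ _) t o
  have h2 := linearScan_scan wb kb bb cb (fun r => normalize η (x r.rev)) hD
    (fun _ => sum_normalize _ _) t.rev o
  rw [← h1, ← h2]
  exact congrFun (Matrix.one_mulVec (m := Fin D') _) o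

/-- A block that applies a network with one hidden layer to each token, followed by `halfScan`. -/
theorem exists_network_block {D D' E : ℕ} (hD : 0 < D) (w : Fin E → Fin D → ℝ) (b : Fin E → ℝ)
    (c : Fin D' → Fin E → ℝ) :
    ∃ B : BiMamba D D', ∀ (n : ℕ) (η : ℝ) (x : TokenSeq n D) (t : Fin n) (o : Fin D'),
      B.eval η x t o = halfScan (fun s => ∑ e, c o e * silu (w e ⬝ᵥ normalize η (x s) + b e))
        (t + 1) t.isLt := by
  -- A kernel of width one with entry `1` leaves the sequence unchanged up to the bias; zero output
  -- weights silence the backward scan.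
  refine ⟨linearBlock (K := 1) (Matrix.of w) 0 (fun _ _ => 1) 0 b 0 (Matrix.of c) 0,
    fun n η x t o => ?_⟩
  rw [linearBlock_eval hD]
  simp only [Matrix.zero_apply, zero_mul, Finset.sum_const_zero, halfScan_zero, add_zero]
  simp [causalConv, Matrix.mulVec]

/-- The kernel whose convolution, followed by `halfScan`, is the shift by `j`. -/
def shiftKernel (K j : ℕ) (k : Fin K) : ℝ :=
  (if (k : ℕ) = j then 1 else 0) - if (k : ℕ) = j + 1 then 2⁻¹ else 0

/-- The value `y_{t-j}`, or zero if there is no such token. -/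
def shifted {n : ℕ} (y : Fin n → ℝ) (j t : ℕ) : ℝ :=
  if h : j ≤ t ∧ t - j < n then y ⟨t - j, h.2⟩ else 0

theorem causalConv_shiftKernel {n E K j : ℕ} (hj : j + 1 < K) (kernel : Fin E → Fin K → ℝ)
    (y : TokenSeq n E) (e : Fin E) (a : ℝ) (he : ∀ k, kernel e k = a * shiftKernel K j k)
    (t : ℕ) (ht : t < n) :
    causalConv kernel 0 y ⟨t, ht⟩ e
      = a * (shifted (fun s => y s e) j t - 2⁻¹ * shifted (fun s => y s e) (j + 1) t) := by
  have key : ∀ (i : ℕ) (_ : i < K) (r : ℝ), (∑ k : Fin K, if (k : ℕ) ≤ t then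
      (if (k : ℕ) = i then r else 0) * y ⟨t - k, lt_of_le_of_lt (Nat.sub_le _ _) ht⟩ e else 0)
      = r * shifted (fun s => y s e) i t := by
    intro i hi r
    rw [Finset.sum_eq_single ⟨i, hi⟩]
    · by_cases hit : i ≤ t
      · have : t - i < n := by omega
        simp [shifted, hit, this]
      · simp [shifted, hit]
    · intro k _ hk
      have : (k : ℕ) ≠ i := fun h => hk (Fin.ext h)
      simp [this]
    · simp
  have h1 := key j (by omega) 1
  have h2 := key (j + 1) hj 2⁻¹
  rw [one_mul] at h1
  simp only [causalConv, Pi.zero_apply, add_zero]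
  rw [← h1, ← h2, ← Finset.sum_sub_distrib, Finset.mul_sum]
  refine Finset.sum_congr rfl fun k _ => ?_
  rw [he, shiftKernel]
  by_cases hk : (k : ℕ) ≤ t
  · simp only [hk, if_true]; ring
  · simp [hk]

/-- The recurrence is solved by the delay `j + 1`, which vanishes at time `0`; the state after token
`t` has index `t + 1`, so the delay seen is `j`. -/
theorem halfScan_shift {n : ℕ} (y : Fin n → ℝ) (j : ℕ) (u : Fin n → ℝ)
    (hu : ∀ t (h : t < n), u ⟨t, h⟩ = shifted y j t - 2⁻¹ * shifted y (j + 1) t) (t : Fin n) :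
    halfScan u (t + 1) t.isLt = shifted y j t := by
  have := halfScan_eq u (fun s => shifted y (j + 1) s) (by simp [shifted]) (fun t h => by
    rw [hu]
    simp [shifted]) (t + 1) t.isLt
  rw [this]
  simp [shifted]

/-- A block that gathers coordinates of the normalized tokens, at prescribed distances to the
left (where `dir` is true) or to the right. -/
theorem exists_shift_block {D W : ℕ} (hD : 0 < D) (dir : Fin W → Bool) (shift : Fin W → ℕ)
    (coord : Fin W → Fin D) :
    ∃ B : BiMamba D W, ∀ (n : ℕ) (η : ℝ) (x : TokenSeq n D) (t : Fin n) (o : Fin W),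
      B.eval η x t o = if dir o then shifted (fun s => normalize η (x s) (coord o)) (shift o) t
        else shifted (fun s => normalize η (x s.rev) (coord o)) (shift o) t.rev := by
  -- Each output gets two channels of opposite sign, whose SiLU values combine to the identity.
  let q : Fin W × Bool ≃ Fin (Fintype.card (Fin W × Bool)) := Fintype.equivFin _
  let sgn : Bool → ℝ := fun s => if s then 1 else -1
  -- Wide enough for the taps at `shift o` and `shift o + 1`, for all `o`.
  let K : ℕ := (∑ o, shift o) + 2
  have hK : ∀ o, shift o + 1 < K := fun o => by
    have := Finset.single_le_sum (f := shift) (fun _ _ => Nat.zero_le _) (Finset.mem_univ o)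
    omega
  let w : Matrix (Fin (Fintype.card (Fin W × Bool))) (Fin D) ℝ :=
    fun e => Pi.single (coord (q.symm e).1) 1
  let ker : Fin (Fintype.card (Fin W × Bool)) → Fin K → ℝ :=
    fun e k => sgn (q.symm e).2 * shiftKernel K (shift (q.symm e).1) k
  let c : Bool → Matrix (Fin W) (Fin (Fintype.card (Fin W × Bool))) ℝ :=
    fun s o e => if (q.symm e).1 = o ∧ dir o = s then sgn (q.symm e).2 else 0
  have key : ∀ (n : ℕ) (z : TokenSeq n D) (s : Bool) (o : Fin W) (t : ℕ) (ht : t < n),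
      ∑ e, c s o e * silu (causalConv ker 0 (fun r => w *ᵥ z r) ⟨t, ht⟩ e)
        = if dir o = s then shifted (fun r => z r (coord o)) (shift o) t
          - 2⁻¹ * shifted (fun r => z r (coord o)) (shift o + 1) t else 0 := by
    intro n z s o t ht
    have h1 : ∀ e, causalConv ker 0 (fun r => w *ᵥ z r) ⟨t, ht⟩ e = sgn (q.symm e).2 *
        (shifted (fun r => z r (coord (q.symm e).1)) (shift (q.symm e).1) t
          - 2⁻¹ * shifted (fun r => z r (coord (q.symm e).1)) (shift (q.symm e).1 + 1) t) := by
      intro e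
      rw [causalConv_shiftKernel (hK (q.symm e).1) ker _ e (sgn (q.symm e).2) (fun _ => rfl)]
      simp [w, Matrix.mulVec]
    simp only [h1]
    have h2 := q.symm.sum_comp (fun p : Fin W × Bool =>
      (if p.1 = o ∧ dir o = s then sgn p.2 else 0) * silu (sgn p.2 *
        (shifted (fun r => z r (coord p.1)) (shift p.1) t
          - 2⁻¹ * shifted (fun r => z r (coord p.1)) (shift p.1 + 1) t)))
    refine h2.trans ?_
    rw [Fintype.sum_prod_type, Finset.sum_eq_single o]
    · by_cases hs : dir o = s
      · simp only [hs, and_self, if_true, Fintype.sum_bool, sgn, one_mul]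
        have := silu_sub_silu_neg (shifted (fun r => z r (coord o)) (shift o) t
          - 2⁻¹ * shifted (fun r => z r (coord o)) (shift o + 1) t)
        simpa [sub_eq_add_neg] using this
      · simp [hs]
    · intro o' _ ho'
      simp [ho']
    · simp
  refine ⟨linearBlock w w ker ker 0 0 (c true) (c false), fun n η x t o => ?_⟩
  rw [linearBlock_eval hD]
  cases hd : dir o
  · have h1 : (fun s : Fin n => ∑ e, c true o e *
        silu (causalConv ker 0 (fun r => w *ᵥ normalize η (x r)) s e)) = fun _ => 0 := by
      funext s
      rw [key n (fun r => normalize η (x r)) true o s s.isLt]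
      simp [hd]
    rw [h1, halfScan_zero, zero_add]
    refine (halfScan_shift (fun s => normalize η (x s.rev) (coord o)) (shift o) _
      (fun s hs => ?_) t.rev).trans (by simp)
    rw [key n (fun r => normalize η (x r.rev)) false o s hs]
    simp [hd]
  · have h1 : (fun s : Fin n => ∑ e, c false o e *
        silu (causalConv ker 0 (fun r => w *ᵥ normalize η (x r.rev)) s e)) = fun _ => 0 := by
      funext s
      rw [key n (fun r => normalize η (x r.rev)) false o s s.isLt]
      simp [hd]
    rw [h1, halfScan_zero, add_zero]
    refine (halfScan_shift (fun s => normalize η (x s) (coord o)) (shift o) _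
      (fun s hs => ?_) t).trans (by simp)
    rw [key n (fun r => normalize η (x r)) true o s hs]
    simp [hd]

/-! ### What normalization and gathering remember. -/

theorem continuous_normalize {D : ℕ} {η : ℝ} (hη : 0 < η) :
    Continuous (normalize η : (Fin D → ℝ) → Fin D → ℝ) := by
  have hm : Continuous fun x : Fin D → ℝ => featureMean x := by
    unfold featureMean
    fun_prop
  have hv : Continuous fun x : Fin D → ℝ => featureVar x := by
    unfold featureVar
    fun_prop
  refine continuous_pi fun i => ?_
  simp only [normalize, layerNorm]
  refine (continuous_const.mul (((continuous_apply i).sub hm).div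
    (Real.continuous_sqrt.comp (hv.add continuous_const)) fun x => ?_)).add continuous_const
  have : 0 ≤ featureVar x := by unfold featureVar; positivity
  exact (Real.sqrt_pos.2 (add_pos_of_nonneg_of_pos this hη)).ne'

/-- Layer normalization forgets only a common translation of the features. -/
theorem exists_eq_add_of_normalize_eq {D : ℕ} {η : ℝ} (hη : 0 < η) {x y : Fin D → ℝ}
    (h : normalize η x = normalize η y) : ∃ c, ∀ i, x i = y i + c := by
  have hvx : 0 ≤ featureVar x := by unfold featureVar; positivity
  have hvy : 0 ≤ featureVar y := by unfold featureVar; positivity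
  have hsx : 0 < Real.sqrt (featureVar x + η) := Real.sqrt_pos.2 (by linarith)
  have hsy : 0 < Real.sqrt (featureVar y + η) := Real.sqrt_pos.2 (by linarith)
  have h1 : ∀ i, (x i - featureMean x) / Real.sqrt (featureVar x + η)
      = (y i - featureMean y) / Real.sqrt (featureVar y + η) := fun i => by
    simpa [normalize, layerNorm] using congrFun h i
  -- This ratio is the variance after normalization; as `η > 0`, it determines the original
  -- variance.
  have h2 : featureVar x / (featureVar x + η) = featureVar y / (featureVar y + η) := by
    have key : ∀ u : Fin D → ℝ, 0 ≤ featureVar u → featureVar u / (featureVar u + η)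
        = (∑ i, ((u i - featureMean u) / Real.sqrt (featureVar u + η)) ^ 2) / D := by
      intro u hu
      simp only [div_pow, Real.sq_sqrt (by linarith : 0 ≤ featureVar u + η)]
      rw [← Finset.sum_div, div_right_comm]
      rfl
    rw [key x hvx, key y hvy]
    simp only [h1]
  have h3 : featureVar x = featureVar y := by
    rw [div_eq_div_iff (by linarith) (by linarith)] at h2
    have : η * featureVar x = η * featureVar y := by linarith
    exact mul_left_cancel₀ hη.ne' this
  refine ⟨featureMean x - featureMean y, fun i => ?_⟩
  have h4 := h1 i
  rw [h3, div_left_inj' hsy.ne'] at h4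
  linarith

/-- All tokens, at their distance from token `t`, to the left or to the right of it. -/
def gather {n D : ℕ} (z : TokenSeq n D) (t : Fin n) (q : Bool × Fin n × Fin D) : ℝ :=
  if q.1 then shifted (fun s => z s q.2.2) q.2.1 t
    else shifted (fun s => z s.rev q.2.2) q.2.1 t.rev

theorem gather_left {n D : ℕ} (z : TokenSeq n D) (t s : Fin n) (h : s ≤ t) (i : Fin D) :
    gather z t (true, ⟨t - s, lt_of_le_of_lt (Nat.sub_le _ _) t.isLt⟩, i) = z s i := by
  have h' : (s : ℕ) ≤ t := h
  have h1 : (t : ℕ) - (t - s) = s := by omega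
  simp [gather, shifted, h1]

theorem gather_right {n D : ℕ} (z : TokenSeq n D) (t s : Fin n) (h : t ≤ s) (i : Fin D) :
    gather z t (false, ⟨s - t, lt_of_le_of_lt (Nat.sub_le _ _) s.isLt⟩, i) = z s i := by
  have h' : (t : ℕ) ≤ s := h
  have hs := s.isLt
  have h1 : (s : ℕ) - t ≤ t.rev ∧ (t.rev : ℕ) - (s - t) < n := by
    simp only [Fin.val_rev]; omega
  have h2 : (⟨(t.rev : ℕ) - (s - t), h1.2⟩ : Fin n).rev = s := by
    ext
    simp only [Fin.val_rev]; omega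
  simp only [gather, shifted]
  rw [dif_pos h1, h2]
  simp

theorem gather_beyond {n D : ℕ} (z : TokenSeq n D) (t s : Fin n) (h : t < s) (i : Fin D) :
    gather z t (true, s, i) = 0 := by
  have h' : ¬ (s : ℕ) ≤ t := not_le.2 h
  simp [gather, shifted, h']

/-- The token at distance `0` has sum `D` on both sides, so `c = 0`. If `t < t'`, the left distance
`t'` reads padding zeros from `t` but the first token from `t'`, whose sum is not zero;
symmetrically for `t' < t`. -/
theorem eq_of_gather_eq_add {n D : ℕ} (hD : 0 < D) {z z' : TokenSeq n D}
    (hz : ∀ s, ∑ i, z s i = D) (hz' : ∀ s, ∑ i, z' s i = D) {t t' : Fin n} {c : ℝ}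
    (h : ∀ q, gather z t q = gather z' t' q + c) : t = t' ∧ z = z' := by
  have hD' : (0 : ℝ) < D := by exact_mod_cast hD
  have hn : 0 < n := t.pos
  have hc : c = 0 := by
    have h1 : ∀ i, z t i = z' t' i + c := fun i => by
      have h2 := h (true, ⟨0, hn⟩, i)
      have h3 := gather_left z t t le_rfl i
      have h4 := gather_left z' t' t' le_rfl i
      simp only [Nat.sub_self] at h3 h4
      rw [h3, h4] at h2
      exact h2
    have h2 := hz t
    simp only [h1, Finset.sum_add_distrib, hz'] at h2
    have h3 : (D : ℝ) * c = 0 := by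
      simpa using h2
    exact (mul_eq_zero.1 h3).resolve_left hD'.ne'
  subst hc
  simp only [add_zero] at h
  have hlt : ∀ {y y' : TokenSeq n D} {s s' : Fin n}, (∀ r, ∑ i, y' r i = D) →
      (∀ q, gather y s q = gather y' s' q) → ¬ s < s' := by
    intro y y' s s' hy' hq hs
    have h1 : ∀ i, y' ⟨0, hn⟩ i = 0 := fun i => by
      have h2 := gather_left y' s' ⟨0, hn⟩ (Nat.zero_le _) i
      simp only [Nat.sub_zero] at h2
      rw [← h2, ← hq, gather_beyond _ _ _ hs]
    have h3 := hy' ⟨0, hn⟩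
    simp only [h1, Finset.sum_const_zero] at h3
    exact hD'.ne h3
  have ht : t = t' := le_antisymm (not_lt.1 (hlt hz fun q => (h q).symm)) (not_lt.1 (hlt hz' h))
  subst ht
  refine ⟨rfl, funext fun s => funext fun i => ?_⟩
  rcases le_total s t with hs | hs
  · rw [← gather_left z t s hs i, h, gather_left z' t s hs i]
  · rw [← gather_right z t s hs i, h, gather_right z' t s hs i]

theorem continuous_shifted {n : ℕ} {X : Type*} [TopologicalSpace X] {y : X → Fin n → ℝ}
    (hy : Continuous y) (j t : ℕ) : Continuous fun x => shifted (y x) j t := by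
  unfold shifted
  split_ifs with h
  · exact (continuous_apply _).comp hy
  · exact continuous_const

theorem continuous_gather {n D : ℕ} (t : Fin n) (q : Bool × Fin n × Fin D) :
    Continuous fun z : TokenSeq n D => gather z t q := by
  unfold gather
  split_ifs
  · exact continuous_shifted (by fun_prop) _ _
  · exact continuous_shifted (by fun_prop) _ _

/-- The number of coordinates of `gather`. -/
abbrev gatherWidth (n D : ℕ) : ℕ := Fintype.card (Bool × Fin n × Fin D)

/-- The normalized token at place `t` after gathering the twice normalized tokens `T`. -/
def representation {n D : ℕ} (η : ℝ) (T : TokenSeq n D) (t : Fin n) :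
    Fin (gatherWidth n D) → ℝ :=
  normalize η fun o =>
    gather (fun s => normalize η (normalize η (T s))) t ((Fintype.equivFin _).symm o)

theorem continuous_representation {n D : ℕ} {η : ℝ} (hη : 0 < η) (t : Fin n) :
    Continuous fun T : TokenSeq n D => representation η T t := by
  refine (continuous_normalize hη).comp (continuous_pi fun o => (continuous_gather t _).comp ?_)
  refine continuous_pi fun s => ?_
  exact ((continuous_normalize hη).comp (continuous_normalize hη)).comp (continuous_apply s)

/-- Each of the three normalizations is undone up to a translation. Fixed sums remove the
translation for the outer two; only that of the original tokens remains. -/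
theorem exists_eq_add_of_representation_eq {n D : ℕ} {η : ℝ} (hη : 0 < η) (hD : 0 < D)
    {T T' : TokenSeq n D} {t t' : Fin n} (h : representation η T t = representation η T' t') :
    t = t' ∧ ∀ s, ∃ c, ∀ i, T s i = T' s i + c := by
  obtain ⟨c, hc⟩ := exists_eq_add_of_normalize_eq hη h
  have h1 := eq_of_gather_eq_add hD (c := c) (fun s => sum_normalize η (normalize η (T s)))
    (fun s => sum_normalize η (normalize η (T' s)))
    (fun q => by simpa using hc (Fintype.equivFin _ q))
  refine ⟨h1.1, fun s => ?_⟩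
  obtain ⟨b, hb⟩ := exists_eq_add_of_normalize_eq hη (congrFun h1.2 s)
  have h2 := sum_normalize η (T s)
  simp only [hb, Finset.sum_add_distrib, sum_normalize] at h2
  have h3 : b = 0 := by
    have h4 : (D : ℝ) * b = 0 := by simpa using h2
    exact (mul_eq_zero.1 h4).resolve_left (by positivity)
  refine exists_eq_add_of_normalize_eq hη (funext fun i => ?_)
  rw [hb, h3, add_zero]

/-! ### Approximation by Graph Mamba Networks. -/

/-- The tokens of the nodes, in the given order. -/
def orderedTokens {d k n : ℕ} (P : Fin n → Fin k → ℝ) (order : Equiv.Perm (Fin n))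
    (X : Fin d → Fin n → ℝ) : TokenSeq n (d + k) :=
  fun t => Fin.append (fun i => X i (order t)) (P (order t))

/-- Networks with one hidden layer on the gathered representation are Graph Mamba Networks,
up to `halfScan`. -/
theorem exists_gmn_of_network {d k n E : ℕ} (hD : 0 < d + k) (hn : 0 < n)
    (w : Fin E → Fin (gatherWidth n (d + k)) → ℝ) (b : Fin E → ℝ) (c : Fin d → Fin E → ℝ) :
    ∃ g : GMN d k, ∀ (η : ℝ) (P : Fin n → Fin k → ℝ) (order : Equiv.Perm (Fin n))
      (X : Fin d → Fin n → ℝ) (i : Fin d) (v : Fin n),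
      g.eval η P order X i v = halfScan (fun s => ∑ e, c i e *
        silu (w e ⬝ᵥ representation η (orderedTokens P order X) s + b e))
          (order.symm v + 1) (order.symm v).isLt := by
  -- Shift zero: the node layer only normalizes its single token.
  obtain ⟨B₀, h₀⟩ := exists_shift_block hD (fun _ : Fin (d + k) => true) (fun _ => 0) id
  let q := (Fintype.equivFin (Bool × Fin n × Fin (d + k))).symm
  obtain ⟨B₁, h₁⟩ := exists_shift_block (W := gatherWidth n (d + k)) hD (fun o => (q o).1)
    (fun o => (q o).2.1) (fun o => (q o).2.2)
  have hW : 0 < gatherWidth n (d + k) :=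
    Fintype.card_pos_iff.2 ⟨(true, ⟨0, hn⟩, ⟨0, hD⟩)⟩
  obtain ⟨B₂, h₂⟩ := exists_network_block hW w b c
  refine ⟨⟨d + k, .single B₀, .cons B₁ (.single B₂)⟩, fun η P order X i v => ?_⟩
  have e₀ : ∀ u : Fin n, B₀.eval η (fun _ : Fin 1 => Fin.append (fun i => X i u) (P u)) 0
      = normalize η (Fin.append (fun i => X i u) (P u)) := fun u => by
    funext o
    rw [h₀]
    simp [shifted]
  have e₁ : ∀ s, normalize η (B₁.eval η (fun t => normalize η (orderedTokens P order X t)) s)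
      = representation η (orderedTokens P order X) s := fun s => by
    rw [representation]
    congr 1
    funext o
    rw [h₁]
    rfl
  simp only [GMN.eval, BiMambaStack.eval, e₀]
  rw [h₂]
  simp only [← e₁]
  rfl

/-- Token sequences with features in `[δ, 1]` and positional encodings with entries `0` and `1`. -/
def tokenSet (d k n : ℕ) (δ : ℝ) : Set (TokenSeq n (d + k)) :=
  Set.univ.pi fun _ => Set.univ.pi
    (Fin.addCases (motive := fun _ => Set ℝ) (fun _ => Set.Icc δ 1) fun _ => {0, 1})

theorem mem_tokenSet {d k n : ℕ} {δ : ℝ} {T : TokenSeq n (d + k)} :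
    T ∈ tokenSet d k n δ ↔ ∀ t, (∀ i, T t (Fin.castAdd k i) ∈ Set.Icc δ 1) ∧
      ∀ j, T t (Fin.natAdd d j) = 0 ∨ T t (Fin.natAdd d j) = 1 := by
  simp only [tokenSet, Set.mem_univ_pi, Fin.forall_fin_add, Fin.addCases_left, Fin.addCases_right,
    Set.mem_insert_iff, Set.mem_singleton_iff]

theorem isCompact_tokenSet (d k n : ℕ) (δ : ℝ) : IsCompact (tokenSet d k n δ) := by
  refine isCompact_univ_pi fun _ => isCompact_univ_pi fun l => ?_
  refine Fin.addCases (fun i => ?_) (fun j => ?_) l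
  · rw [Fin.addCases_left]; exact isCompact_Icc
  · rw [Fin.addCases_right]; exact (Set.toFinite _).isCompact

/-- The remaining translation is a difference of entries in `{0, 1}`, hence `-1`, `0` or `1`, and
also a difference of two points of `[δ, 1]`, hence less than `1` in absolute value. -/
theorem representation_injOn {d k n : ℕ} {η δ : ℝ} (hη : 0 < η) (hδ : 0 < δ) (hd : 0 < d)
    (hk : 0 < k) {T T' : TokenSeq n (d + k)} (hT : T ∈ tokenSet d k n δ)
    (hT' : T' ∈ tokenSet d k n δ) {t t' : Fin n}
    (h : representation η T t = representation η T' t') : T = T' ∧ t = t' := by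
  obtain ⟨ht, h1⟩ := exists_eq_add_of_representation_eq hη (by omega) h
  refine ⟨funext fun s => ?_, ht⟩
  obtain ⟨c, hc⟩ := h1 s
  have a := mem_tokenSet.1 hT s
  have a' := mem_tokenSet.1 hT' s
  have x := a.1 ⟨0, hd⟩
  have x' := a'.1 ⟨0, hd⟩
  have hx := hc (Fin.castAdd k ⟨0, hd⟩)
  have hp := hc (Fin.natAdd d ⟨0, hk⟩)
  have h0 : c = 0 := by
    rcases a.2 ⟨0, hk⟩ with h2 | h2 <;> rcases a'.2 ⟨0, hk⟩ with h3 | h3 <;> rw [h2, h3] at hp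
    · linarith
    · linarith [x.1, x'.2]
    · linarith [x.2, x'.1]
    · linarith
  funext i
  rw [hc, h0, add_zero]

theorem abs_shifted_le {n : ℕ} {y : Fin n → ℝ} {M : ℝ} (hM : 0 ≤ M) (hy : ∀ s, |y s| ≤ M)
    (j t : ℕ) : |shifted y j t| ≤ M := by
  unfold shifted
  split_ifs
  · exact hy _
  · simpa using hM

/-- Approximation of a sequence to sequence map on the tokens with features in `[δ, 1]`, with a
bound on all tokens that does not depend on `δ`. -/
theorem exists_network_approximation {d k n : ℕ} {η δ M ε : ℝ} (hη : 0 < η) (hδ : 0 < δ)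
    (hd : 0 < d) (hk : 0 < k) (hε : 0 < ε) (F : TokenSeq n (d + k) → Fin d → Fin n → ℝ)
    (hF : ContinuousOn F (tokenSet d k n δ)) (hM : 0 ≤ M)
    (hFM : ∀ T ∈ tokenSet d k n δ, ∀ i t, |F T i t| ≤ M) :
    ∃ (E : ℕ) (w : Fin E → Fin (gatherWidth n (d + k)) → ℝ) (b : Fin E → ℝ)
      (c : Fin d → Fin E → ℝ), ∀ i,
      (∀ T ∈ tokenSet d k n 0, ∀ t : Fin n,
        |∑ e, c i e * silu (w e ⬝ᵥ representation η T t + b e)| ≤ 2 * M + ε) ∧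
      ∀ T ∈ tokenSet d k n δ, ∀ t : Fin n,
        |∑ e, c i e * silu (w e ⬝ᵥ representation η T t + b e)
          - (shifted (F T i) 0 t - 2⁻¹ * shifted (F T i) 1 t)| ≤ ε := by
  have hsub : tokenSet d k n δ ⊆ tokenSet d k n 0 := fun T hT => by
    rw [mem_tokenSet] at hT ⊢
    exact fun t => ⟨fun i => ⟨hδ.le.trans ((hT t).1 i).1, ((hT t).1 i).2⟩, (hT t).2⟩
  have : CompactSpace (tokenSet d k n δ) :=
    isCompact_iff_compactSpace.1 (isCompact_tokenSet d k n δ)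
  let R : tokenSet d k n δ × Fin n → Fin (gatherWidth n (d + k)) → ℝ :=
    fun y => representation η y.1 y.2
  -- A continuous injection of a compact space; thus the target becomes a function on a closed set
  -- of representations.
  have hR : Topology.IsClosedEmbedding R := by
    refine Continuous.isClosedEmbedding ?_ ?_
    · rw [continuous_prod_of_discrete_right]
      exact fun t => (continuous_representation hη t).comp continuous_subtype_val
    · rintro ⟨⟨T, hT⟩, t⟩ ⟨⟨T', hT'⟩, t'⟩ h
      obtain ⟨rfl, rfl⟩ := representation_injOn hη hδ hd hk hT hT' h
      rfl
  have hext : ∀ i : Fin d, ∃ h : C(Fin (gatherWidth n (d + k)) → ℝ, ℝ),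
      (∀ x, |h x| ≤ 2 * M) ∧ ∀ T ∈ tokenSet d k n δ, ∀ t : Fin n,
        h (representation η T t) = shifted (F T i) 0 t - 2⁻¹ * shifted (F T i) 1 t := by
    intro i
    let φ : C(tokenSet d k n δ × Fin n, ℝ) :=
      ⟨fun y => shifted (F y.1 i) 0 y.2 - 2⁻¹ * shifted (F y.1 i) 1 y.2, by
        rw [continuous_prod_of_discrete_right]
        intro t
        have hFi : Continuous fun T : tokenSet d k n δ => F T i :=
          (continuous_apply i).comp (continuousOn_iff_continuous_domRestrict.1 hF)
        have h0 := continuous_shifted hFi 0 t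
        have h1 := continuous_shifted hFi 1 t
        exact h0.sub (continuous_const.mul h1)⟩
    -- Tietze extension keeps the bound `2 * M`, which is independent of `δ`.
    obtain ⟨h, h1, h2⟩ :=
      BoundedContinuousFunction.exists_extension_forall_mem_Icc_of_isClosedEmbedding
      (BoundedContinuousFunction.mkOfCompact φ) (a := -(2 * M)) (b := 2 * M) (e := R)
      (fun y => by
        have a := abs_le.1 (abs_shifted_le hM (hFM y.1 y.1.2 i) 0 y.2)
        have a' := abs_le.1 (abs_shifted_le hM (hFM y.1 y.1.2 i) 1 y.2)
        simp only [BoundedContinuousFunction.mkOfCompact_apply, φ, ContinuousMap.coe_mk]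
        constructor <;> linarith [a.1, a.2, a'.1, a'.2]) (by linarith) hR
    refine ⟨h.toContinuousMap, fun x => abs_le.2 (h1 x), fun T hT t => ?_⟩
    exact congrFun h2 (⟨T, hT⟩, t)
  choose h hb hh using hext
  -- The network approximates the extension on representations of all tokens, including those with
  -- features below `δ`, so it inherits the bound there.
  have hK : IsCompact (⋃ t : Fin n, (fun T => representation η T t) '' tokenSet d k n 0) :=
    isCompact_iUnion fun t =>
      (isCompact_tokenSet d k n 0).image (continuous_representation hη t)
  obtain ⟨E, w, b, c, H⟩ := exists_silu_network_pi hK h hε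
  refine ⟨E, w, b, c, fun i => ⟨fun T hT t => ?_, fun T hT t => ?_⟩⟩
  · have h1 := abs_lt.1 (H i _ (Set.mem_iUnion.2 ⟨t, T, hT, rfl⟩))
    have h2 := abs_le.1 (hb i (representation η T t))
    rw [abs_le]
    constructor <;> linarith [h1.1, h1.2, h2.1, h2.2]
  · rw [← hh i T hT t]
    exact (H i _ (Set.mem_iUnion.2 ⟨t, T, hsub hT, rfl⟩)).le

theorem orderedTokens_mem_tokenSet {d k n : ℕ} (G : Digraph (Fin n)) (order : Equiv.Perm (Fin n))
    {X : Fin d → Fin n → ℝ} {δ : ℝ} (hX : ∀ i v, X i v ∈ Set.Icc δ 1) :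
    orderedTokens (paddedAdjacency G k) order X ∈ tokenSet d k n δ := by
  rw [mem_tokenSet]
  refine fun t => ⟨fun i => ?_, fun j => ?_⟩
  · rw [orderedTokens, Fin.append_left]
    exact hX _ _
  · rw [orderedTokens, Fin.append_right, paddedAdjacency]
    split_ifs <;> simp

/-- Approximation that is uniform away from the faces of the cube where a feature vanishes, with a
bound on the whole cube that does not depend on the distance from these faces. -/
theorem exists_gmn_approximation {d k n : ℕ} (hd : 0 < d) (hk : 0 < k) (hn : 0 < n) {η : ℝ}
    (hη : 0 < η) {f : (Fin d → Fin n → ℝ) → (Fin d → Fin n → ℝ)}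
    (hf : ContinuousOn f (cube d n)) (hequiv : PermutationEquivariant f) :
    ∃ B : ℝ, 0 ≤ B ∧ ∀ δ ε : ℝ, 0 < δ → 0 < ε → ∃ g : GMN d k,
      ∀ (G : Digraph (Fin n)) (order : Equiv.Perm (Fin n)), ∀ X ∈ cube d n, ∀ i v,
        |f X i v - g.eval η (paddedAdjacency G k) order X i v| ≤ B ∧
        ((∀ i v, δ ≤ X i v) → |f X i v - g.eval η (paddedAdjacency G k) order X i v| ≤ ε) := by
  have hcube : IsCompact (cube d n) := by
    have : cube d n = Set.univ.pi fun _ => Set.univ.pi fun _ => Set.Icc (0 : ℝ) 1 := by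
      ext X; simp only [cube, Set.mem_ofPred_eq, Set.mem_univ_pi]
    rw [this]
    exact isCompact_univ_pi fun _ => isCompact_univ_pi fun _ => isCompact_Icc
  obtain ⟨M', hM'⟩ := hcube.exists_bound_of_continuousOn hf
  let M := max M' 0
  have hM : ∀ X ∈ cube d n, ∀ i v, |f X i v| ≤ M := fun X hX i v =>
    ((norm_le_pi_norm (f X i) v).trans (norm_le_pi_norm (f X) i)).trans
      ((hM' X hX).trans (le_max_left _ _))
  have hM0 : 0 ≤ M := le_max_right _ _
  -- The network is at most `2 * M + 1/2`, the recurrence doubles this, and `f` contributes `M`.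
  refine ⟨5 * M + 1, by positivity, fun δ ε hδ hε => ?_⟩
  let feat : TokenSeq n (d + k) → Fin d → Fin n → ℝ := fun T i t => T t (Fin.castAdd k i)
  have hfeat : ∀ T ∈ tokenSet d k n δ, feat T ∈ cube d n := fun T hT i v => by
    have := ((mem_tokenSet.1 hT) v).1 i
    exact ⟨hδ.le.trans this.1, this.2⟩
  obtain ⟨E, w, b, c, H⟩ := exists_network_approximation (k := k) (ε := min (ε / 2) 2⁻¹) hη hδ hd hk
    (by positivity) (fun T => f (feat T))
    (hf.comp (Continuous.continuousOn (by fun_prop)) hfeat) hM0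
    (fun T hT => hM _ (hfeat T hT))
  obtain ⟨g, hg⟩ := exists_gmn_of_network (d := d) (k := k) (by omega) hn w b c
  have hε1 : min (ε / 2) 2⁻¹ ≤ ε / 2 := min_le_left _ _
  have hε2 : min (ε / 2) (2⁻¹ : ℝ) ≤ 2⁻¹ := min_le_right _ _
  have hε0 : 0 ≤ min (ε / 2) (2⁻¹ : ℝ) := by positivity
  refine ⟨g, fun G order X hX i v => ?_⟩
  rw [hg]
  set u : Fin n → ℝ := fun s => ∑ e, c i e *
    silu (w e ⬝ᵥ representation η (orderedTokens (paddedAdjacency G k) order X) s + b e) with hu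
  constructor
  · have hT := orderedTokens_mem_tokenSet (k := k) G order hX
    have h1 := abs_halfScan_sub_le u (fun _ => 0) rfl (ε := 2 * M + min (ε / 2) 2⁻¹)
      (by positivity) (fun t ht => by simpa [hu, -le_inf_iff] using (H i).1 _ hT ⟨t, ht⟩)
      (order.symm v + 1) (order.symm v).isLt
    rw [sub_zero] at h1
    have h2 := abs_le.1 h1
    have h3 := abs_le.1 (hM X hX i v)
    rw [abs_le]
    constructor <;> linarith [h2.1, h2.2, h3.1, h3.2]
  · intro hδX
    have hT := orderedTokens_mem_tokenSet (k := k) (δ := δ) G order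
      fun i v => ⟨hδX i v, (hX i v).2⟩
    set T := orderedTokens (paddedAdjacency G k) order X with hTdef
    have h1 := abs_halfScan_sub_le u (fun s => shifted (f (feat T) i) 1 s) (by simp [shifted])
      (ε := min (ε / 2) 2⁻¹) hε0 (fun t ht => by
        have := (H i).2 T hT ⟨t, ht⟩
        simpa [hu, shifted, hTdef] using this) (order.symm v + 1) (order.symm v).isLt
    have h2 : feat T = fun i v => X i (order v) := by
      funext i t
      simp [feat, hTdef, orderedTokens]
    -- Equivariance: the value for the permuted matrix at the place of `v` is the value of `f X` at
    -- `v`.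
    have h3 : shifted (f (feat T) i) 1 (order.symm v + 1) = f X i v := by
      rw [h2, hequiv order X hX]
      simp [shifted]
    rw [h3] at h1
    rw [abs_sub_comm]
    linarith

/-! ### From uniform bounds to the `p`-norm distance. -/

/-- The part of the cube where all entries are at least `δ`. -/
def innerCube (d n : ℕ) (δ : ℝ) : Set (Fin d → Fin n → ℝ) :=
  Set.univ.pi fun _ => Set.univ.pi fun _ => Set.Icc δ 1

theorem cube_eq_innerCube (d n : ℕ) : cube d n = innerCube d n 0 := by
  ext X
  simp only [cube, innerCube, Set.mem_ofPred_eq, Set.mem_univ_pi]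

theorem measurableSet_innerCube (d n : ℕ) (δ : ℝ) : MeasurableSet (innerCube d n δ) :=
  MeasurableSet.univ_pi fun _ => MeasurableSet.univ_pi fun _ => measurableSet_Icc

theorem volume_innerCube {d n : ℕ} {δ : ℝ} (hδ : δ ≤ 1) :
    volume (innerCube d n δ) = ENNReal.ofReal (((1 - δ) ^ n) ^ d) := by
  have h : (0 : ℝ) ≤ 1 - δ := by linarith
  rw [innerCube, volume_pi_pi]
  simp only [volume_pi_pi, Real.volume_Icc, Finset.prod_const, Finset.card_univ, Fintype.card_fin]
  rw [ENNReal.ofReal_pow (by positivity), ENNReal.ofReal_pow h]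

theorem exists_volume_cube_diff_innerCube_le (d n : ℕ) {r : ℝ} (hr : 0 < r) :
    ∃ δ, 0 < δ ∧ volume (cube d n \ innerCube d n δ) ≤ ENNReal.ofReal r := by
  have hc : Filter.Tendsto (fun δ : ℝ => 1 - ((1 - δ) ^ n) ^ d) (nhdsWithin 0 (Set.Ioi 0))
      (nhds 0) := by
    have : Continuous fun δ : ℝ => 1 - ((1 - δ) ^ n) ^ d := by fun_prop
    have h := this.tendsto 0
    simp only [sub_zero, one_pow, sub_self] at h
    exact h.mono_left nhdsWithin_le_nhds
  obtain ⟨δ, ⟨h1, h2⟩, h3⟩ := ((hc.eventually (gt_mem_nhds hr)).and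
    (Ioo_mem_nhdsGT (zero_lt_one' ℝ))).exists.imp fun δ h => And.intro h.2 h.1
  have hδ : (0 : ℝ) ≤ 1 - δ := by linarith
  refine ⟨δ, h1, ?_⟩
  have hsub : innerCube d n δ ⊆ innerCube d n 0 := Set.pi_mono fun _ _ => Set.pi_mono fun _ _ =>
    Set.Icc_subset_Icc_left h1.le
  rw [cube_eq_innerCube, measure_sdiff hsub (measurableSet_innerCube d n δ).nullMeasurableSet
    (by rw [volume_innerCube h2.le]; exact ENNReal.ofReal_ne_top), volume_innerCube h2.le,
    volume_innerCube zero_le_one, ← ENNReal.ofReal_sub _ (by positivity)]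
  refine ENNReal.ofReal_le_ofReal ?_
  simpa using h3.le

/-- The integral splits into the inner cube, of volume at most `1` and with entrywise error `ε`, and
the rest, of volume at most `r` and with error `B`. -/
theorem lpDist_le {d n : ℕ} {p B ε δ r : ℝ} (hp : 0 < p) (hB : 0 ≤ B) (hr : 0 ≤ r) (hε : 0 ≤ ε)
    {f g : (Fin d → Fin n → ℝ) → (Fin d → Fin n → ℝ)}
    (hb : ∀ X ∈ cube d n, ∀ i v, |f X i v - g X i v| ≤ B)
    (hδ : ∀ X ∈ cube d n, (∀ i v, δ ≤ X i v) → ∀ i v, |f X i v - g X i v| ≤ ε)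
    (hvol : volume (cube d n \ innerCube d n δ) ≤ ENNReal.ofReal r) :
    lpDist p f g ≤ ENNReal.ofReal (d * n * ε ^ p + d * n * B ^ p * r) ^ (1 / p) := by
  refine ENNReal.rpow_le_rpow ?_ (by positivity)
  have hmc : MeasurableSet (cube d n) := by
    rw [cube_eq_innerCube]; exact measurableSet_innerCube d n 0
  have hmi := measurableSet_innerCube d n δ
  have hsum : ∀ X C, (∀ i v, |f X i v - g X i v| ≤ C) →
      ENNReal.ofReal (∑ i, ∑ v, |f X i v - g X i v| ^ p) ≤ ENNReal.ofReal (d * n * C ^ p) := by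
    intro X C hC
    refine ENNReal.ofReal_le_ofReal ?_
    calc ∑ i, ∑ v, |f X i v - g X i v| ^ p ≤ ∑ _i : Fin d, ∑ _v : Fin n, C ^ p :=
          Finset.sum_le_sum fun i _ => Finset.sum_le_sum fun v _ =>
            Real.rpow_le_rpow (abs_nonneg _) (hC i v) hp.le
      _ = d * n * C ^ p := by simp [mul_assoc]
  have hone : volume (cube d n ∩ innerCube d n δ) ≤ 1 := by
    refine (measure_mono Set.inter_subset_left).trans ?_
    rw [cube_eq_innerCube, volume_innerCube zero_le_one]
    simp
  rw [← lintegral_inter_add_sdiff _ (cube d n) hmi,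
    ENNReal.ofReal_add (by positivity) (by positivity), ENNReal.ofReal_mul
      (show (0 : ℝ) ≤ d * n * B ^ p by positivity)]
  refine add_le_add ?_ ?_
  · refine (setLIntegral_mono' (hmc.inter hmi) (g := fun _ => ENNReal.ofReal (d * n * ε ^ p))
      fun X hX => hsum X ε (hδ X hX.1 fun i v => ?_)).trans ?_
    · exact ((Set.mem_univ_pi.1 ((Set.mem_univ_pi.1 hX.2) i)) v).1
    · rw [setLIntegral_const]
      exact mul_le_of_le_one_right' hone
  · refine (setLIntegral_mono' (hmc.diff hmi) (g := fun _ => ENNReal.ofReal (d * n * B ^ p))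
      fun X hX => hsum X B (hb X hX.1)).trans ?_
    rw [setLIntegral_const]
    gcongr

theorem lpDist_eq_zero_of_isEmpty {d n : ℕ} {p : ℝ} (hp : 0 < p) (h : d = 0 ∨ n = 0)
    (f g : (Fin d → Fin n → ℝ) → (Fin d → Fin n → ℝ)) : lpDist p f g = 0 := by
  have : ∀ X : Fin d → Fin n → ℝ, ∑ i, ∑ v, |f X i v - g X i v| ^ p = 0 := by
    rcases h with rfl | rfl <;> simp
  simp [lpDist, this, hp]

theorem nonempty_gmn (d k : ℕ) : Nonempty (GMN d k) :=
  ⟨⟨0, .single (linearBlock (E := 0) (K := 0) 0 0 0 0 0 0 0 0),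
    .single (linearBlock (E := 0) (K := 0) 0 0 0 0 0 0 0 0)⟩⟩

end GraphMamba

end

theorem mainTheorem1 (d n k : ℕ) (hk : n ≤ k) (η : ℝ) (hη : 0 < η)
    (p : ℝ) (hp : 1 ≤ p) (ε : ℝ) (hε : 0 < ε)
    (f : (Fin d → Fin n → ℝ) → (Fin d → Fin n → ℝ))
    (hf : ContinuousOn f (GraphMamba.cube d n))
    (hequiv : GraphMamba.PermutationEquivariant f) :
    ∃ g : GraphMamba.GMN d k,
      ∀ (G : Digraph (Fin n)) (order : Equiv.Perm (Fin n)),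
        GraphMamba.lpDist p f (g.eval η (GraphMamba.paddedAdjacency G k) order)
          < ENNReal.ofReal ε := by
  have hp0 : 0 < p := by linarith
  by_cases h0 : d = 0 ∨ n = 0
  · obtain ⟨g⟩ := GraphMamba.nonempty_gmn d k
    refine ⟨g, fun G order => ?_⟩
    rw [GraphMamba.lpDist_eq_zero_of_isEmpty hp0 h0]
    exact ENNReal.ofReal_pos.2 hε
  · obtain ⟨hd, hn⟩ := not_or.1 h0
    obtain ⟨B, hB, H⟩ := GraphMamba.exists_gmn_approximation (k := k) (Nat.pos_of_ne_zero hd)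
      (by omega) (Nat.pos_of_ne_zero hn) hη hf hequiv
    have hεp : 0 < ε ^ p := Real.rpow_pos_of_pos hε p
    have hC : (0 : ℝ) ≤ d * n := by positivity
    generalize hCdef : (d * n : ℝ) = C at hC
    have hBp : 0 ≤ C * B ^ p := by positivity
    -- Chosen so that the boundary region contributes at most `ε ^ p / 2`; the `+ 1` keeps the
    -- denominator positive.
    have hr : 0 < ε ^ p / (2 * (C * B ^ p + 1)) := by positivity
    obtain ⟨δ, hδ, hvol⟩ := GraphMamba.exists_volume_cube_diff_innerCube_le d n hr
    have ht : 0 < (2 * (C + 1))⁻¹ := by positivity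
    have ht1 : (2 * (C + 1))⁻¹ ≤ 1 := inv_le_one_of_one_le₀ (by linarith)
    obtain ⟨g, hg⟩ := H δ ((2 * (C + 1))⁻¹ * ε) hδ (by positivity)
    refine ⟨g, fun G order => ?_⟩
    refine (GraphMamba.lpDist_le hp0 hB hr.le (by positivity)
      (fun X hX i v => (hg G order X hX i v).1)
      (fun X hX hX' i v => (hg G order X hX i v).2 hX') hvol).trans_lt ?_
    have e : ENNReal.ofReal ε = ENNReal.ofReal (ε ^ p) ^ (1 / p) := by
      rw [ENNReal.ofReal_rpow_of_pos hεp, ← Real.rpow_mul hε.le, mul_one_div_cancel hp0.ne',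
        Real.rpow_one]
    rw [e]
    refine ENNReal.rpow_lt_rpow ((ENNReal.ofReal_lt_ofReal_iff hεp).2 ?_) (by positivity)
    rw [hCdef]
    have h1 : C * ((2 * (C + 1))⁻¹ * ε) ^ p < ε ^ p / 2 := by
      rw [Real.mul_rpow ht.le hε.le]
      -- Since the base is at most `1` and `p ≥ 1`, one factor suffices to beat the number `C` of
      -- entries.
      have h2 : ((2 * (C + 1))⁻¹ : ℝ) ^ p ≤ (2 * (C + 1))⁻¹ := by
        simpa using Real.rpow_le_rpow_of_exponent_ge ht ht1 hp
      have h3 : C * (2 * (C + 1))⁻¹ < 1 / 2 := by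
        rw [← div_eq_mul_inv, div_lt_div_iff₀ (by positivity) two_pos]
        linarith
      have h4 := mul_le_mul_of_nonneg_left h2 hC
      have h5 := mul_lt_mul_of_pos_right (h4.trans_lt h3) hεp
      linarith
    have h2 : C * B ^ p * (ε ^ p / (2 * (C * B ^ p + 1))) ≤ ε ^ p / 2 := by
      rw [mul_div_assoc', div_le_div_iff₀ (by positivity) two_pos]
      linarith
    linarith
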